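/- Let $n\ge 2$ and let $M$ be an oriented $C^\infty$ Riemannian manifold of dimension $n$. Let $J\subset\mathbb R$ be a nontrivial interval and $c:J\to M$ a curve of class $C^n$. Let $D$ be the Levi-Civita covariant derivative along $c$, and put $c^{(1)}=c'$, $c^{(k+1)}=Dc^{(k)}$. Assume that $c$ is regular: for every $t\in J$ the vectors $c'(t),\dots,c^{(n-1)}(t)\in T_{c(t)}M$ are linearly independent. Let $e=(e_1,\dots,e_n)$ be the Frenet-Serret frame of $c$: for each $t$, the vectors $e_1(t),\dots,e_{n-1}(t)$ are the Gram-Schmidt orthonormalization of $c'(t),\dots,c^{(n-1)}(t)$, and $e_n(t)$ is the unit vector for which $e_1(t),\dots,e_n(t)$ is a positive orthonormal basis of $T_{c(t)}M$. Let $F(t)$ be the Frenet-Serret matrix, that is, the $n\times n$ matrix with $De=\|c'\|\,F\,e$ (so $F_{ij}=\langle De_i,e_j\rangle/\|c'\|$), and let $\kappa_r=F_{r,r+1}$, $1\le r\le n-1$, be the curvatures of $c$. Denote by $\operatorname{vol}(v_1,\dots,v_k)=\sqrt{\det(\langle v_i,v_j\rangle)_{i,j}}$ the $k$-volume of the parallelepiped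 spanned by $v_1,\dots,v_k$ (equal to $1$ for $k=0$), and by $\det(v_1,\dots,v_n)$ the determinant of the coefficients of $v_1,\dots,v_n\in T_{c(t)}M$ with respect to a positive orthonormal basis. Then at every $t\in J$, for $1\le r\le n-2$, $$\kappa_r=\frac{\operatorname{vol}(c',\dots,c^{(r-1)})\,\operatorname{vol}(c',\dots,c^{(r+1)})}{\operatorname{vol}(c',\dots,c^{(r)})^2}\,\|c'\|^{-1},$$ and the top curvature (torsion) satisfies $$\kappa_{n-1}=\frac{\operatorname{vol}(c',\dots,c^{(n-2)})\,\det(c',\dots,c^{(n)})}{\operatorname{vol}(c',\dots,c^{(n-1)})^2}\,\|c'\|^{-1}.$$ -/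

import Mathlib

open Bundle Manifold
open scoped Topology ContDiff

noncomputable section

namespace FrenetSerret

section Fiber

variable {n : ℕ} {M : Type*} [TopologicalSpace M] [ChartedSpace (EuclideanSpace ℝ (Fin n)) M]

instance tangentFiniteDimensional (x : M) : FiniteDimensional ℝ (TangentSpace (𝓡 n) x) :=
  inferInstanceAs (FiniteDimensional ℝ (EuclideanSpace ℝ (Fin n)))

theorem finrank_tangent (x : M) : Module.finrank ℝ (TangentSpace (𝓡 n) x) = n :=
  finrank_euclideanSpace_fin (𝕜 := ℝ) (n := n)

instance tangentFinrankFact (x : M) : Fact (Module.finrank ℝ (TangentSpace (𝓡 n) x) = n) :=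
  ⟨finrank_tangent x⟩

end Fiber

/-- An orientation of an `n`-dimensional manifold: an orientation of every tangent space that is
locally constant when it is read in charts. -/
structure ManifoldOrientation (n : ℕ) (M : Type*) [TopologicalSpace M]
    [ChartedSpace (EuclideanSpace ℝ (Fin n)) M] [IsManifold (𝓡 n) ∞ M] where
  orient : ∀ x : M, Orientation ℝ (TangentSpace (𝓡 n) x) (Fin n)
  locally_constant : ∀ x₀ : M, ∀ᶠ x in 𝓝 x₀,
    ∃ hx : x ∈ (trivializationAt (EuclideanSpace ℝ (Fin n)) (TangentSpace (𝓡 n)) x₀).baseSet,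
      Orientation.map (Fin n)
          ((trivializationAt (EuclideanSpace ℝ (Fin n))
            (TangentSpace (𝓡 n)) x₀).linearEquivAt ℝ x hx) (orient x) =
        Orientation.map (Fin n)
          ((trivializationAt (EuclideanSpace ℝ (Fin n))
            (TangentSpace (𝓡 n)) x₀).linearEquivAt ℝ x₀
              (FiberBundle.mem_baseSet_trivializationAt' x₀)) (orient x₀)

/-- The `k`-dimensional volume of the parallelepiped spanned by `v₁, …, v_k`: the square root of
the Gram determinant. It is `1` for the empty family. -/
def kVolume {V : Type*} [NormedAddCommGroup V] [InnerProductSpace ℝ V] {k : ℕ}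
    (v : Fin k → V) : ℝ :=
  Real.sqrt (Matrix.gram ℝ v).det

/-- The positive orthonormal frame obtained from `f₁, …, f_n` in an oriented euclidean space when
`f₁, …, f_{n-1}` are linearly independent: `e₁, …, e_{n-1}` is their Gram-Schmidt
orthonormalization, and `e_n` is the unit vector orthogonal to them whose sign makes
`e₁, …, e_n` positive. (Mathlib's `gramSchmidtOrthonormalBasis` completes the orthonormalization
to an orthonormal basis `b`, whose determinant is `1` or `-1`.) -/
def positiveFrame {V : Type*} [NormedAddCommGroup V] [InnerProductSpace ℝ V]
    [FiniteDimensional ℝ V] {n : ℕ} [hn : Fact (Module.finrank ℝ V = n)]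
    (o : Orientation ℝ V (Fin n)) (f : Fin n → V) (i : Fin n) : V :=
  let b := InnerProductSpace.gramSchmidtOrthonormalBasis
    (hn.out.trans (Fintype.card_fin n).symm) f
  if (i : ℕ) + 1 = n then o.volumeForm b • b i else b i

section Curves

variable {n : ℕ} {M : Type*} [TopologicalSpace M] [ChartedSpace (EuclideanSpace ℝ (Fin n)) M]
  [IsManifold (𝓡 n) ∞ M]

/-- The coordinate vector field `∂ᵢ` of the chart around `x₀`, at the point with coordinates `y`. -/
def coordVector (x₀ : M) (y : EuclideanSpace ℝ (Fin n)) (i : Fin n) :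
    TangentSpace (𝓡 n) ((extChartAt (𝓡 n) x₀).symm y) :=
  (trivializationAt (EuclideanSpace ℝ (Fin n)) (TangentSpace (𝓡 n)) x₀).symmL ℝ
    ((extChartAt (𝓡 n) x₀).symm y) (EuclideanSpace.single i 1)

variable (n) in
/-- The velocity `c'(t)` of a curve defined on `J`. -/
def velocity (J : Set ℝ) (c : ℝ → M) (t : ℝ) : TangentSpace (𝓡 n) (c t) :=
  mfderivWithin 𝓘(ℝ, ℝ) (𝓡 n) c J t (1 : ℝ)

variable [RiemannianBundle (fun x : M ↦ TangentSpace (𝓡 n) x)]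

/-- The matrix `(g_ij)` of the metric in the chart around `x₀`, at the coordinates `y`. -/
def metricMatrix (x₀ : M) (y : EuclideanSpace ℝ (Fin n)) : Matrix (Fin n) (Fin n) ℝ :=
  Matrix.of fun i j ↦ inner ℝ (coordVector x₀ y i) (coordVector x₀ y j)

/-- The partial derivative `∂_l g_ij` in the chart around `x₀`. -/
def metricPartial (x₀ : M) (y : EuclideanSpace ℝ (Fin n)) (l i j : Fin n) : ℝ :=
  fderiv ℝ (fun z ↦ metricMatrix x₀ z i j) y (EuclideanSpace.single l 1)

/-- The Christoffel symbols of the Levi-Civita connection in the chart around `x₀`: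
`Γ^k_ij = ½ ∑_l g^{kl} (∂_i g_jl + ∂_j g_il - ∂_l g_ij)`. -/
def christoffel (x₀ : M) (y : EuclideanSpace ℝ (Fin n)) (k i j : Fin n) : ℝ :=
  (1 / 2) * ∑ l, (metricMatrix x₀ y)⁻¹ k l *
    (metricPartial x₀ y i j l + metricPartial x₀ y j i l - metricPartial x₀ y l i j)

/-- The Levi-Civita covariant derivative along `c : J → M` of a vector field `V` along `c`,
computed in the chart around `x₀`:
`(DV)^k = dV^k/dt + ∑_ij Γ^k_ij(c) (dc^i/dt) V^j`. -/
def covDerivInChart (x₀ : M) (J : Set ℝ) (c : ℝ → M)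
    (V : ∀ t, TangentSpace (𝓡 n) (c t)) (t : ℝ) : TangentSpace (𝓡 n) (c t) :=
  let triv := trivializationAt (EuclideanSpace ℝ (Fin n)) (TangentSpace (𝓡 n)) x₀
  let x : ℝ → EuclideanSpace ℝ (Fin n) := fun s ↦ extChartAt (𝓡 n) x₀ (c s)
  let v : ℝ → EuclideanSpace ℝ (Fin n) := fun s ↦ (triv ⟨c s, V s⟩).2
  triv.symmL ℝ (c t) (derivWithin v J t +
    WithLp.toLp 2 fun k ↦ ∑ i, ∑ j, christoffel x₀ (x t) k i j * derivWithin x J t i * v t j)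

variable (n) in
/-- The Levi-Civita covariant derivative `D` along the curve `c : J → M`. -/
def covDeriv (J : Set ℝ) (c : ℝ → M) (V : ∀ t, TangentSpace (𝓡 n) (c t)) (t : ℝ) :
    TangentSpace (𝓡 n) (c t) :=
  covDerivInChart (c t) J c V t

variable (n) in
/-- The consecutive covariant derivatives of the curve: `curveDeriv n J c k t` is
`c^{(k+1)}(t) = D^k c'(t)`. -/
def curveDeriv (J : Set ℝ) (c : ℝ → M) : ℕ → ∀ t, TangentSpace (𝓡 n) (c t)
  | 0 => velocity n J c
  | k + 1 => covDeriv n J c (curveDeriv J c k)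

variable (n) in
/-- A regular curve: `c` is of class `C^n` on `J`, and `c', …, c^{(n-1)}` are linearly independent
at every parameter. -/
structure IsRegularCurve (J : Set ℝ) (c : ℝ → M) : Prop where
  contMDiffOn : ContMDiffOn 𝓘(ℝ, ℝ) (𝓡 n) n c J
  linearIndependent : ∀ t ∈ J,
    LinearIndependent ℝ fun i : Fin (n - 1) ↦ curveDeriv n J c (i : ℕ) t

variable (n) in
/-- The volume `vol(c', …, c^{(k)})` at `t`. -/
def curveVolume (J : Set ℝ) (c : ℝ → M) (k : ℕ) (t : ℝ) : ℝ :=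
  kVolume fun i : Fin k ↦ curveDeriv n J c (i : ℕ) t

/-- The determinant `det(c', …, c^{(n)})` at `t`, with respect to positive orthonormal bases. -/
def curveDet (o : ManifoldOrientation n M) (J : Set ℝ) (c : ℝ → M) (t : ℝ) : ℝ :=
  (o.orient (c t)).volumeForm fun i : Fin n ↦ curveDeriv n J c (i : ℕ) t

/-- The Frenet-Serret frame of a regular curve, with `e₁, …, e_n` indexed from `0`. -/
def frenetFrame (o : ManifoldOrientation n M) (J : Set ℝ) (c : ℝ → M) (i : Fin n) (t : ℝ) :
    TangentSpace (𝓡 n) (c t) :=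
  positiveFrame (o.orient (c t)) (fun j : Fin n ↦ curveDeriv n J c (j : ℕ) t) i

/-- The Frenet-Serret matrix `F(t)`, that is, the matrix with `D e = ‖c'‖ F e`; its entries are
the coordinates of `D eᵢ / ‖c'‖` in the orthonormal frame `e`. -/
def frenetMatrix (o : ManifoldOrientation n M) (J : Set ℝ) (c : ℝ → M) (t : ℝ) :
    Matrix (Fin n) (Fin n) ℝ :=
  Matrix.of fun i j ↦
    inner ℝ (covDeriv n J c (frenetFrame o J c i) t) (frenetFrame o J c j t) / ‖velocity n J c t‖

/-- The curvature `κ_r`, `1 ≤ r ≤ n - 1`: the entry of the Frenet-Serret matrix in row `r` and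
column `r + 1` (counted from `1`). -/
def curvature (o : ManifoldOrientation n M) (J : Set ℝ) (c : ℝ → M) (r : ℕ) (hr : r < n)
    (t : ℝ) : ℝ :=
  frenetMatrix o J c t ⟨r - 1, (Nat.sub_le r 1).trans_lt hr⟩ ⟨r, hr⟩

end Curves

end FrenetSerret

end

noncomputable section

namespace FrenetSerret

/-! ### Gram-Schmidt vectors, volumes and determinants. -/

section LinearAlgebra

open InnerProductSpace Finset

variable {V : Type*} [NormedAddCommGroup V] [InnerProductSpace ℝ V]

/-! Let `w_0, w_1, …` be the Gram-Schmidt vectors of `c', c'', …`. Volumes are products of the norms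
`‖w_i‖` (`kVolume_eq_prod`), so the quotient of volumes in `κ_r` collapses to `‖w_r‖ / ‖w_{r-1}‖`.
On the other side, `D w_k` is `c^{(k+2)}` plus a combination of `c', …, c^{(k+1)}`
(`hasCovDerivAt_orthoDeriv`), and the next frame vector is orthogonal to that combination. Hence
`⟨De, e⁺⟩ = ‖w_k‖⁻¹ ⟨e⁺, c^{(k+2)}⟩` for `e = w_k / ‖w_k‖` and its successor `e⁺`
(`inner_covDeriv_frenetFrame`). The last inner product is `‖w_{k+1}‖` if `e⁺` is not the last frame
vector; otherwise it is read off from the determinant (`volumeForm_eq_prod_mul_inner`).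

Of `D` only additivity and the Leibniz rule are used, not compatibility with the metric. The
analytic work lies elsewhere: `covDeriv` at `t` is computed in the chart at `c t`, which moves with
`t`. Iterating it requires independence of the chart (`covCoord_eq_fderiv`), that is, the
transformation law of the Christoffel symbols, obtained here from the Koszul formula. -/

theorem gramSchmidt_comp_val (f : ℕ → V) {k : ℕ} (i : Fin k) :
    gramSchmidt ℝ (fun j : Fin k ↦ f j) i = gramSchmidt ℝ f i := by
  obtain ⟨i, hi⟩ := i
  induction i using Nat.strong_induction_on with
  | _ i ih =>
    rw [gramSchmidt_def, gramSchmidt_def]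
    congr 1
    have hmap : (Iio (i : ℕ)) = (Iio (⟨i, hi⟩ : Fin k)).map Fin.valEmbedding := by
      simp
    change _ = ∑ j ∈ Iio i, _
    rw [hmap, sum_map]
    refine sum_congr rfl fun j hj ↦ ?_
    have hj' : (j : ℕ) < i := by simpa [Fin.lt_def] using hj
    simp only [Fin.valEmbedding_apply]
    simp only [← ih j hj' j.2]

/-- `f r` differs from its Gram-Schmidt vector by earlier ones, which are orthogonal to it. -/
theorem inner_gramSchmidt_self (f : ℕ → V) (r : ℕ) :
    inner ℝ (gramSchmidt ℝ f r) (f r) = ‖gramSchmidt ℝ f r‖ ^ 2 := by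
  rw [gramSchmidt_def'' ℝ f r]
  simp only [RCLike.ofReal_real_eq_id, id_eq]
  rw [inner_add_right, real_inner_self_eq_norm_sq, inner_sum, sum_eq_zero, add_zero]
  intro i hi
  rw [inner_smul_right, gramSchmidt_orthogonal ℝ f (Finset.mem_Iio.1 hi).ne', mul_zero]

/-- The Gram determinant is the product of the squared norms of the Gram-Schmidt vectors. -/
theorem det_gram_eq_prod {k : ℕ} (v : Fin k → V) :
    (Matrix.gram ℝ v).det = ∏ i, ‖gramSchmidt ℝ v i‖ ^ 2 := by
  let w := gramSchmidt ℝ v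
  -- `L` is the unitriangular matrix expressing `v` in `w`; the Gram matrix is then `L D Lᵀ` with
  -- `D` diagonal. Where `w j = 0` the division by zero is harmless, since the coefficient
  -- multiplies `w j`.
  let L : Matrix (Fin k) (Fin k) ℝ := Matrix.of fun i j ↦
    if j < i then inner ℝ (w j) (v i) / ‖w j‖ ^ 2 else if j = i then 1 else 0
  have hL : ∀ i, v i = ∑ j, L i j • w j := by
    intro i
    rw [gramSchmidt_def'' ℝ v i]
    have : ∀ j, L i j • w j = (if j = i then w i else 0) +
        if j < i then (inner ℝ (w j) (v i) / ‖w j‖ ^ 2) • w j else 0 := by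
      intro j
      simp only [L, Matrix.of_apply]
      rcases lt_trichotomy j i with h | h | h
      · simp [h, h.ne]
      · simp [h]
      · simp [h.not_gt, h.ne']
    rw [sum_congr rfl fun j _ ↦ this j, sum_add_distrib, sum_ite_eq', if_pos (mem_univ _),
      ← sum_filter]
    congr 1
    exact sum_congr (by ext; simp) fun _ _ ↦ rfl
  have hgram : Matrix.gram ℝ v = L * Matrix.diagonal (fun i ↦ ‖w i‖ ^ 2) * L.transpose := by
    ext i j
    rw [Matrix.gram_apply, Matrix.mul_apply]
    simp only [Matrix.mul_diagonal, Matrix.transpose_apply]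
    rw [hL i, hL j, sum_inner]
    refine sum_congr rfl fun a _ ↦ ?_
    rw [inner_sum, sum_eq_single a]
    · rw [inner_smul_left, inner_smul_right, real_inner_self_eq_norm_sq]
      simp only [conj_trivial]
      ring
    · intro b _ hb
      rw [inner_smul_left, inner_smul_right, gramSchmidt_orthogonal ℝ v hb.symm]
      simp
    · simp
  have hdet : L.det = 1 := by
    rw [Matrix.det_of_isLowerTriangular L]
    · simp [L]
    · intro i j hij
      have hij' : i < j := hij
      simp [L, hij'.not_gt, hij'.ne']
  rw [hgram, Matrix.det_mul, Matrix.det_mul, Matrix.det_transpose, hdet, Matrix.det_diagonal]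
  simp [w]

theorem kVolume_eq_prod (f : ℕ → V) (k : ℕ) :
    kVolume (fun i : Fin k ↦ f i) = ∏ i ∈ range k, ‖gramSchmidt ℝ f i‖ := by
  rw [kVolume, det_gram_eq_prod, prod_pow, Real.sqrt_sq (prod_nonneg fun _ _ ↦ norm_nonneg _),
    prod_range]
  simp_rw [gramSchmidt_comp_val]

theorem gramSchmidt_ne_zero_of_linearIndependent (f : ℕ → V) {k : ℕ}
    (hf : LinearIndependent ℝ fun i : Fin k ↦ f i) {i : ℕ} (hi : i < k) :
    gramSchmidt ℝ f i ≠ 0 := by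
  have := gramSchmidt_ne_zero (𝕜 := ℝ) (⟨i, hi⟩ : Fin k) hf
  rwa [gramSchmidt_comp_val f ⟨i, hi⟩] at this

variable [FiniteDimensional ℝ V] {n : ℕ} [hn : Fact (Module.finrank ℝ V = n)]

/-- Where the Gram-Schmidt vector vanishes, the basis vector is an unspecified completion; hence
`hw`. -/
theorem gramSchmidtOrthonormalBasis_eq (f : ℕ → V) {i : Fin n} (hw : gramSchmidt ℝ f i ≠ 0) :
    gramSchmidtOrthonormalBasis (hn.out.trans (Fintype.card_fin n).symm) (fun j : Fin n ↦ f j) i =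
      ‖gramSchmidt ℝ f i‖⁻¹ • gramSchmidt ℝ f i := by
  have h : gramSchmidtNormed ℝ (fun j : Fin n ↦ f j) i =
      ‖gramSchmidt ℝ f i‖⁻¹ • gramSchmidt ℝ f i := by
    rw [gramSchmidtNormed, gramSchmidt_comp_val]
    rfl
  rw [gramSchmidtOrthonormalBasis_apply _ (by rw [h]; simpa using hw), h]

theorem positiveFrame_eq (o : Orientation ℝ V (Fin n)) (f : ℕ → V) {i : Fin n}
    (hi : (i : ℕ) + 1 < n) (hw : gramSchmidt ℝ f i ≠ 0) :
    positiveFrame o (fun j : Fin n ↦ f j) i = ‖gramSchmidt ℝ f i‖⁻¹ • gramSchmidt ℝ f i := by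
  simp only [positiveFrame, hi.ne, if_false]
  exact gramSchmidtOrthonormalBasis_eq f hw

theorem inner_positiveFrame_eq_zero (o : Orientation ℝ V (Fin n)) (f : Fin n → V) {i j : Fin n}
    (hij : j < i) : inner ℝ (positiveFrame o f i) (f j) = 0 := by
  simp only [positiveFrame]
  split_ifs
  · rw [inner_smul_left, gramSchmidtOrthonormalBasis_inv_triangular _ f hij, mul_zero]
  · exact gramSchmidtOrthonormalBasis_inv_triangular _ f hij

/-- The matrix of `f` in the basis `b` is triangular with diagonal `⟨b i, f i⟩`, equal to the norms
for `i < m`. The sign `o.volumeForm b` is absorbed by the last vector of the positive frame.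
Independence of the full family is not needed, so the determinant may vanish. -/
theorem volumeForm_eq_prod_mul_inner (o : Orientation ℝ V (Fin n)) (f : ℕ → V) {m : ℕ}
    (hm : m + 1 = n) (hw : ∀ i < m, gramSchmidt ℝ f i ≠ 0) :
    o.volumeForm (fun i : Fin n ↦ f i) = (∏ i ∈ range m, ‖gramSchmidt ℝ f i‖) *
      inner ℝ (positiveFrame o (fun j : Fin n ↦ f j) ⟨m, by omega⟩) (f m) := by
  subst hm
  have hb (i : Fin m) := gramSchmidtOrthonormalBasis_eq (n := m + 1) f (i := i.castSucc) (hw i i.2)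
  set b := gramSchmidtOrthonormalBasis (hn.out.trans (Fintype.card_fin (m + 1)).symm)
    (fun j : Fin (m + 1) ↦ f j) with hbdef
  have hdet : b.toBasis.det (fun j : Fin (m + 1) ↦ f j) = ∏ i, inner ℝ (b i) (f i) :=
    gramSchmidtOrthonormalBasis_det _ _
  have hlast : positiveFrame o (fun j : Fin (m + 1) ↦ f j) ⟨m, by omega⟩ =
      o.volumeForm b • b (Fin.last m) := by
    simp only [positiveFrame, if_true]
    rfl
  have hvol : o.volumeForm (fun i : Fin (m + 1) ↦ f i) =
      o.volumeForm b * b.toBasis.det (fun i : Fin (m + 1) ↦ f i) := by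
    conv_lhs => rw [o.volumeForm.eq_smul_basis_det b.toBasis]
    simp
  rw [hvol, hlast, hdet, Fin.prod_univ_castSucc, inner_smul_left, prod_range]
  have : ∀ i : Fin m, inner ℝ (b i.castSucc) (f i.castSucc) = ‖gramSchmidt ℝ f i‖ := by
    intro i
    have h0 : ‖gramSchmidt ℝ f i‖ ≠ 0 := norm_ne_zero_iff.2 (hw i i.2)
    rw [hb i, inner_smul_left, Fin.val_castSucc, inner_gramSchmidt_self]
    simp only [conj_trivial]
    field_simp
  rw [prod_congr rfl fun i _ ↦ this i]
  simp only [conj_trivial, Fin.val_last]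
  ring

end LinearAlgebra

set_option maxSynthPendingDepth 3

/-! ### The Koszul expression and its behaviour under isometries. -/

section BilinearForm

variable {E : Type*} [NormedAddCommGroup E] [NormedSpace ℝ E] {ι : Type*} [Fintype ι]

/-- The bilinear form with matrix `A` with respect to the coordinate functionals `p`. -/
def formOfMatrix (p : ι → E →L[ℝ] ℝ) (A : Matrix ι ι ℝ) : E →L[ℝ] E →L[ℝ] ℝ :=
  ∑ i, ∑ j, A i j • (p i).smulRight (p j)

theorem formOfMatrix_apply (p : ι → E →L[ℝ] ℝ) (A : Matrix ι ι ℝ) (v w : E) :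
    formOfMatrix p A v w = ∑ i, ∑ j, p i v * p j w * A i j := by
  simp only [formOfMatrix, sum_apply, smul_apply, ContinuousLinearMap.smulRight_apply, smul_eq_mul]
  exact Finset.sum_congr rfl fun i _ ↦ Finset.sum_congr rfl fun j _ ↦ by ring

theorem hasFDerivAt_formOfMatrix (p : ι → E →L[ℝ] ℝ) {G : E → Matrix ι ι ℝ} {y : E}
    (hG : ∀ i j, DifferentiableAt ℝ (fun z ↦ G z i j) y) :
    HasFDerivAt (fun z ↦ formOfMatrix p (G z))
      (∑ i, ∑ j, (fderiv ℝ (fun z ↦ G z i j) y).smulRight ((p i).smulRight (p j))) y := by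
  unfold formOfMatrix
  exact HasFDerivAt.fun_sum fun i _ ↦ HasFDerivAt.fun_sum fun j _ ↦
    (hG i j).hasFDerivAt.smul_const _

theorem fderiv_formOfMatrix_apply (p : ι → E →L[ℝ] ℝ) {G : E → Matrix ι ι ℝ} {y : E}
    (hG : ∀ i j, DifferentiableAt ℝ (fun z ↦ G z i j) y) (u v w : E) :
    fderiv ℝ (fun z ↦ formOfMatrix p (G z)) y u v w =
      ∑ i, ∑ j, p i v * p j w * fderiv ℝ (fun z ↦ G z i j) y u := by
  rw [(hasFDerivAt_formOfMatrix p hG).fderiv]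
  simp only [sum_apply, smul_apply, ContinuousLinearMap.smulRight_apply, smul_eq_mul]
  exact Finset.sum_congr rfl fun i _ ↦ Finset.sum_congr rfl fun j _ ↦ by ring

/-- The right-hand side of the Koszul formula for the metric `B` and constant vector fields. -/
def koszul (B : E → E →L[ℝ] E →L[ℝ] ℝ) (y u v w : E) : ℝ :=
  (1 / 2) * (fderiv ℝ B y u v w + fderiv ℝ B y v u w - fderiv ℝ B y w u v)

/-- The transformation law of the Christoffel symbols under a change of coordinates, in terms of
the Koszul formula. -/
theorem koszul_eq_of_isometry {B B' : E → E →L[ℝ] E →L[ℝ] ℝ} {φ : E → E} {y : E}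
    (hφ : ContDiffAt ℝ 2 φ y) (hB0 : DifferentiableAt ℝ B y) (hB' : DifferentiableAt ℝ B' (φ y))
    (hcomm : ∀ a b, B' (φ y) a b = B' (φ y) b a)
    (hiso : ∀ᶠ z in 𝓝 y, ∀ v w, B z v w = B' (φ z) (fderiv ℝ φ z v) (fderiv ℝ φ z w))
    (u v w : E) :
    koszul B y u v w = koszul B' (φ y) (fderiv ℝ φ y u) (fderiv ℝ φ y v) (fderiv ℝ φ y w) +
      B' (φ y) (fderiv ℝ (fderiv ℝ φ) y u v) (fderiv ℝ φ y w) := by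
  have hD2 (a b : E) : fderiv ℝ (fderiv ℝ φ) y a b = fderiv ℝ (fderiv ℝ φ) y b a :=
    (hφ.isSymmSndFDerivAt (by simp)).eq a b
  -- The derivative of the isometry identity: one term from `B'`, one from each factor `dφ`. In the
  -- Koszul combination, symmetry of `B'` and of the second derivative of `φ` cancels the
  -- second-order terms except two equal ones.
  have hderiv (a b w : E) : fderiv ℝ B y a b w =
      fderiv ℝ B' (φ y) (fderiv ℝ φ y a) (fderiv ℝ φ y b) (fderiv ℝ φ y w) +
      B' (φ y) (fderiv ℝ (fderiv ℝ φ) y a b) (fderiv ℝ φ y w) +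
      B' (φ y) (fderiv ℝ φ y b) (fderiv ℝ (fderiv ℝ φ) y a w) := by
    have hA : HasFDerivAt (fderiv ℝ φ) (fderiv ℝ (fderiv ℝ φ) y) y :=
      ((hφ.fderiv_right (m := 1) (by norm_num)).differentiableAt one_ne_zero).hasFDerivAt
    have hφ1 : HasFDerivAt φ (fderiv ℝ φ y) y :=
      (hφ.differentiableAt two_ne_zero).hasFDerivAt
    have e1 := (hB0.hasFDerivAt.clm_apply (hasFDerivAt_const b y)).clm_apply
      (hasFDerivAt_const w y)
    have e2 := ((hB'.hasFDerivAt.comp y hφ1).clm_apply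
      (hA.clm_apply (hasFDerivAt_const b y))).clm_apply (hA.clm_apply (hasFDerivAt_const w y))
    have e3 := e2.congr_of_eventuallyEq (hiso.mono fun z hz ↦ hz b w)
    have := congrArg (fun L : E →L[ℝ] ℝ ↦ L a) (e1.unique e3)
    simp at this
    rw [this]
    ring
  simp only [koszul]
  rw [hderiv, hderiv, hderiv, hD2 v u, hD2 w u, hD2 w v,
    hcomm (fderiv ℝ φ y u), hcomm (fderiv ℝ φ y v)]
  ring

end BilinearForm

/-! ### Christoffel symbols of a matrix-valued metric. -/

section Coordinates

variable {n : ℕ}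

theorem euclidean_eq_sum (v : EuclideanSpace ℝ (Fin n)) : v = ∑ i, v i • EuclideanSpace.single i (1 : ℝ) := by
  conv_lhs => rw [← (EuclideanSpace.basisFun (Fin n) ℝ).sum_repr v]
  simp

/-- The bilinear form with matrix `A`. -/
def matrixForm (A : Matrix (Fin n) (Fin n) ℝ) :
    EuclideanSpace ℝ (Fin n) →L[ℝ] EuclideanSpace ℝ (Fin n) →L[ℝ] ℝ :=
  formOfMatrix (fun i ↦ EuclideanSpace.proj (𝕜 := ℝ) i) A

theorem matrixForm_apply (A : Matrix (Fin n) (Fin n) ℝ) (v w : EuclideanSpace ℝ (Fin n)) :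
    matrixForm A v w = ∑ i, ∑ j, v i * w j * A i j :=
  formOfMatrix_apply _ A v w

variable {G : EuclideanSpace ℝ (Fin n) → Matrix (Fin n) (Fin n) ℝ} {y : EuclideanSpace ℝ (Fin n)}

theorem fderiv_matrixForm_apply (hG : ∀ i j, DifferentiableAt ℝ (fun z ↦ G z i j) y)
    (u v w : EuclideanSpace ℝ (Fin n)) : fderiv ℝ (fun z ↦ matrixForm (G z)) y u v w =
      ∑ l, ∑ i, ∑ j, u l * v i * w j *
        fderiv ℝ (fun z ↦ G z i j) y (EuclideanSpace.single l 1) := by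
  have h (i j : Fin n) : fderiv ℝ (fun z ↦ G z i j) y u =
      ∑ l, u l * fderiv ℝ (fun z ↦ G z i j) y (EuclideanSpace.single l 1) := by
    conv_lhs => rw [euclidean_eq_sum u]
    simp only [map_sum, map_smul, smul_eq_mul]
  refine (fderiv_formOfMatrix_apply _ hG u v w).trans ?_
  simp only [h, Finset.mul_sum]
  rw [Finset.sum_congr rfl fun i _ ↦ Finset.sum_comm, Finset.sum_comm]
  exact Finset.sum_congr rfl fun l _ ↦ Finset.sum_congr rfl fun i _ ↦
    Finset.sum_congr rfl fun j _ ↦ by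
      simp
      ring

/-- The Christoffel symbols of the metric with matrix `G`, in coordinates. -/
def matrixChristoffel (G : EuclideanSpace ℝ (Fin n) → Matrix (Fin n) (Fin n) ℝ)
    (y : EuclideanSpace ℝ (Fin n)) (k i j : Fin n) : ℝ :=
  (1 / 2) * ∑ l, (G y)⁻¹ k l *
    (fderiv ℝ (fun z ↦ G z j l) y (EuclideanSpace.single i 1) +
      fderiv ℝ (fun z ↦ G z i l) y (EuclideanSpace.single j 1) -
      fderiv ℝ (fun z ↦ G z i j) y (EuclideanSpace.single l 1))

/-- The vector `Γ(u, v)` with coordinates `∑ Γ^k_ij u^i v^j`. -/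
def christoffelVec (G : EuclideanSpace ℝ (Fin n) → Matrix (Fin n) (Fin n) ℝ)
    (y u v : EuclideanSpace ℝ (Fin n)) : EuclideanSpace ℝ (Fin n) :=
  WithLp.toLp 2 fun k ↦ ∑ i, ∑ j, matrixChristoffel G y k i j * u i * v j

theorem christoffelVec_add (u v w : EuclideanSpace ℝ (Fin n)) :
    christoffelVec G y u (v + w) = christoffelVec G y u v + christoffelVec G y u w := by
  ext k
  simp only [christoffelVec, PiLp.add_apply, mul_add, Finset.sum_add_distrib]

theorem christoffelVec_smul (a : ℝ) (u v : EuclideanSpace ℝ (Fin n)) :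
    christoffelVec G y u (a • v) = a • christoffelVec G y u v := by
  ext k
  simp only [christoffelVec, PiLp.smul_apply, smul_eq_mul, Finset.mul_sum]
  exact Finset.sum_congr rfl fun i _ ↦ Finset.sum_congr rfl fun j _ ↦ by ring

/-- The Koszul formula in coordinates. -/
theorem matrixForm_christoffelVec (hG : ∀ i j, DifferentiableAt ℝ (fun z ↦ G z i j) y)
    (hsymm : ∀ i j, G y i j = G y j i) (hdet : IsUnit (G y).det) (u v w : EuclideanSpace ℝ (Fin n)) :
    matrixForm (G y) (christoffelVec G y u v) w =
      koszul (fun z ↦ matrixForm (G z)) y u v w := by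
  let d : Fin n → Fin n → Fin n → ℝ := fun l i j ↦
    fderiv ℝ (fun z ↦ G z i j) y (EuclideanSpace.single l 1)
  -- Half of `K l` is `Γ(u, v)` with its index lowered, so pairing by `G y` cancels the inverse
  -- matrix.
  let K : Fin n → ℝ := fun l ↦ ∑ i, ∑ j, (d i j l + d j i l - d l i j) * (u i * v j)
  have hΓ : christoffelVec G y u v = WithLp.toLp 2 ((G y)⁻¹.mulVec ((1 / 2 : ℝ) • K)) := by
    ext k
    simp only [christoffelVec, matrixChristoffel, Matrix.mulVec, dotProduct, Pi.smul_apply,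
      smul_eq_mul, K, d, Finset.mul_sum, Finset.sum_mul]
    rw [Finset.sum_congr rfl fun i _ ↦ Finset.sum_comm, Finset.sum_comm]
    exact Finset.sum_congr rfl fun l _ ↦ Finset.sum_congr rfl fun i _ ↦
      Finset.sum_congr rfl fun j _ ↦ by ring
  have hG' : ∀ l, ∑ i, G y i l * christoffelVec G y u v i = (1 / 2) * K l := by
    intro l
    have : (G y).mulVec (christoffelVec G y u v).ofLp = (1 / 2 : ℝ) • K := by
      rw [hΓ]
      simp [Matrix.mulVec_mulVec, Matrix.mul_nonsing_inv _ hdet]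
    simp_rw [hsymm _ l]
    exact congrFun this l
  have h1 : matrixForm (G y) (christoffelVec G y u v) w = ∑ l, w l * ((1 / 2) * K l) := by
    rw [matrixForm_apply, Finset.sum_comm]
    refine Finset.sum_congr rfl fun l _ ↦ ?_
    rw [← hG', Finset.mul_sum]
    exact Finset.sum_congr rfl fun i _ ↦ by ring
  have h2 : fderiv ℝ (fun z ↦ matrixForm (G z)) y u v w =
      ∑ l, ∑ i, ∑ j, w l * u i * v j * d i j l := by
    rw [fderiv_matrixForm_apply hG]
    calc _ = ∑ i, ∑ l, ∑ j, u i * v j * w l * d i j l :=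
          Finset.sum_congr rfl fun i _ ↦ Finset.sum_comm
      _ = ∑ l, ∑ i, ∑ j, u i * v j * w l * d i j l := Finset.sum_comm
      _ = _ := Finset.sum_congr rfl fun l _ ↦ Finset.sum_congr rfl fun i _ ↦
          Finset.sum_congr rfl fun j _ ↦ by ring
  have h3 : fderiv ℝ (fun z ↦ matrixForm (G z)) y v u w =
      ∑ l, ∑ i, ∑ j, w l * u i * v j * d j i l := by
    rw [fderiv_matrixForm_apply hG]
    calc _ = ∑ i, ∑ j, ∑ l, v j * u i * w l * d j i l := Finset.sum_comm
      _ = ∑ i, ∑ l, ∑ j, v j * u i * w l * d j i l :=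
          Finset.sum_congr rfl fun i _ ↦ Finset.sum_comm
      _ = ∑ l, ∑ i, ∑ j, v j * u i * w l * d j i l := Finset.sum_comm
      _ = _ := Finset.sum_congr rfl fun l _ ↦ Finset.sum_congr rfl fun i _ ↦
          Finset.sum_congr rfl fun j _ ↦ by ring
  rw [h1, koszul, h2, h3, fderiv_matrixForm_apply hG]
  simp only [← Finset.sum_add_distrib, ← Finset.sum_sub_distrib, Finset.mul_sum, K]
  exact Finset.sum_congr rfl fun l _ ↦ Finset.sum_congr rfl fun i _ ↦
    Finset.sum_congr rfl fun j _ ↦ by ring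

theorem eq_of_matrixForm_eq {A : Matrix (Fin n) (Fin n) ℝ} (hA : IsUnit A.det) {a b : EuclideanSpace ℝ (Fin n)}
    (h : ∀ w, matrixForm A a w = matrixForm A b w) : a = b := by
  have : a.ofLp = b.ofLp := by
    refine Matrix.vecMul_injective_of_isUnit ((Matrix.isUnit_iff_isUnit_det A).2 hA) ?_
    ext j
    have hj := h (EuclideanSpace.single j 1)
    simp only [matrixForm_apply] at hj
    simpa [Matrix.vecMul, dotProduct] using hj
  exact WithLp.ofLp_injective 2 this

/-- The transformation law of the Christoffel symbols under a change of coordinates. -/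
theorem fderiv_christoffelVec {G' : EuclideanSpace ℝ (Fin n) → Matrix (Fin n) (Fin n) ℝ} {φ : EuclideanSpace ℝ (Fin n) → EuclideanSpace ℝ (Fin n)}
    (hφ : ContDiffAt ℝ 2 φ y) (hφs : Function.Surjective (fderiv ℝ φ y))
    (hG : ∀ i j, DifferentiableAt ℝ (fun z ↦ G z i j) y)
    (hsymm : ∀ i j, G y i j = G y j i) (hdet : IsUnit (G y).det)
    (hG' : ∀ i j, DifferentiableAt ℝ (fun z ↦ G' z i j) (φ y))
    (hsymm' : ∀ i j, G' (φ y) i j = G' (φ y) j i) (hdet' : IsUnit (G' (φ y)).det)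
    (hiso : ∀ᶠ z in 𝓝 y, ∀ v w, matrixForm (G z) v w =
      matrixForm (G' (φ z)) (fderiv ℝ φ z v) (fderiv ℝ φ z w)) (u v : EuclideanSpace ℝ (Fin n)) :
    fderiv ℝ φ y (christoffelVec G y u v) =
      christoffelVec G' (φ y) (fderiv ℝ φ y u) (fderiv ℝ φ y v) +
        fderiv ℝ (fderiv ℝ φ) y u v := by
  have hcomm (a b : EuclideanSpace ℝ (Fin n)) :
      matrixForm (G' (φ y)) a b = matrixForm (G' (φ y)) b a := by
    rw [matrixForm_apply, matrixForm_apply, Finset.sum_comm]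
    refine Finset.sum_congr rfl fun i _ ↦ Finset.sum_congr rfl fun j _ ↦ ?_
    rw [hsymm' j i]
    ring
  refine eq_of_matrixForm_eq hdet' fun w' ↦ ?_
  -- By nondegeneracy it suffices to pair with every vector, and each is of the form `dφ w`.
  obtain ⟨w, rfl⟩ := hφs w'
  have h := koszul_eq_of_isometry hφ (hasFDerivAt_formOfMatrix _ hG).differentiableAt
    (hasFDerivAt_formOfMatrix _ hG').differentiableAt hcomm hiso u v w
  rw [← hiso.self_of_nhds, matrixForm_christoffelVec hG hsymm hdet, map_add, add_apply,
    matrixForm_christoffelVec hG' hsymm' hdet']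
  exact h

/-- The inverse matrix is the adjugate over the determinant, both polynomial in the entries. -/
theorem contDiffAt_matrixChristoffel (hG : ∀ i j, ContDiffAt ℝ ∞ (fun z ↦ G z i j) y)
    (hdet : (G y).det ≠ 0) (k i j : Fin n) :
    ContDiffAt ℝ ∞ (fun z ↦ matrixChristoffel G z k i j) y := by
  have hdetC (F : EuclideanSpace ℝ (Fin n) → Matrix (Fin n) (Fin n) ℝ)
      (hF : ∀ i j, ContDiffAt ℝ ∞ (fun z ↦ F z i j) y) :
      ContDiffAt ℝ ∞ (fun z ↦ (F z).det) y := by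
    simp only [Matrix.det_apply']
    exact ContDiffAt.sum fun σ _ ↦ contDiffAt_const.mul (contDiffAt_prod fun i _ ↦ hF _ _)
  have hinv (k l : Fin n) : ContDiffAt ℝ ∞ (fun z ↦ (G z)⁻¹ k l) y := by
    simp only [Matrix.inv_def, Ring.inverse_eq_inv', Matrix.smul_apply, smul_eq_mul,
      Matrix.adjugate_apply]
    refine ((hdetC G hG).inv hdet).mul (hdetC _ fun a b ↦ ?_)
    by_cases h : a = l
    · subst h
      simpa using contDiffAt_const
    · simpa [Matrix.updateRow_ne h] using hG a b
  have hpart (l i j : Fin n) : ContDiffAt ℝ ∞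
      (fun z ↦ fderiv ℝ (fun x ↦ G x i j) z (EuclideanSpace.single l 1)) y :=
    ((hG i j).fderiv_right (by simp)).clm_apply contDiffAt_const
  unfold matrixChristoffel
  exact contDiffAt_const.mul (ContDiffAt.sum fun l _ ↦ (hinv k l).mul
    (((hpart i j l).add (hpart j i l)).sub (hpart l i j)))

end Coordinates

/-! ### Tangent coordinates and the metric in the charts of `M`. -/

section Metric

variable {n : ℕ} {M : Type*} [TopologicalSpace M] [ChartedSpace (EuclideanSpace ℝ (Fin n)) M]
  [IsManifold (𝓡 n) ∞ M]

theorem mem_baseSet_iff (x₀ p : M) :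
    p ∈ (trivializationAt (EuclideanSpace ℝ (Fin n)) (TangentSpace (𝓡 n)) x₀).baseSet ↔
      p ∈ (extChartAt (𝓡 n) x₀).source := by
  rw [TangentBundle.trivializationAt_baseSet, extChartAt_source]

theorem symm_mem_baseSet (x₀ : M) {y : EuclideanSpace ℝ (Fin n)}
    (hy : y ∈ (extChartAt (𝓡 n) x₀).target) : (extChartAt (𝓡 n) x₀).symm y ∈
      (trivializationAt (EuclideanSpace ℝ (Fin n)) (TangentSpace (𝓡 n)) x₀).baseSet :=
  (mem_baseSet_iff x₀ _).2 ((extChartAt (𝓡 n) x₀).map_target hy)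

/-- The coordinates of the tangent vector `v` at `p` in the chart around `x₀`. -/
def tangentCoord (x₀ p : M) (v : TangentSpace (𝓡 n) p) : EuclideanSpace ℝ (Fin n) :=
  (trivializationAt (EuclideanSpace ℝ (Fin n)) (TangentSpace (𝓡 n)) x₀ ⟨p, v⟩).2

theorem tangentCoord_eq (x₀ : M) {p : M} (hp : p ∈ (extChartAt (𝓡 n) x₀).source)
    (v : TangentSpace (𝓡 n) p) : tangentCoord x₀ p v =
      (trivializationAt (EuclideanSpace ℝ (Fin n)) (TangentSpace (𝓡 n)) x₀).continuousLinearMapAt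
        ℝ p v :=
  (Trivialization.continuousLinearMapAt_apply_of_mem (R := ℝ) _ ((mem_baseSet_iff x₀ p).2 hp) v).symm

theorem tangentCoord_symmL (x₀ : M) {p : M} (hp : p ∈ (extChartAt (𝓡 n) x₀).source)
    (v : EuclideanSpace ℝ (Fin n)) : tangentCoord x₀ p
      ((trivializationAt (EuclideanSpace ℝ (Fin n)) (TangentSpace (𝓡 n)) x₀).symmL ℝ p v) = v := by
  rw [tangentCoord_eq x₀ hp]
  exact Trivialization.continuousLinearMapAt_symmL _ ((mem_baseSet_iff x₀ p).2 hp) v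

theorem symmL_tangentCoord (x₀ : M) {p : M} (hp : p ∈ (extChartAt (𝓡 n) x₀).source)
    (v : TangentSpace (𝓡 n) p) :
    (trivializationAt (EuclideanSpace ℝ (Fin n)) (TangentSpace (𝓡 n)) x₀).symmL ℝ p
      (tangentCoord x₀ p v) = v := by
  rw [tangentCoord_eq x₀ hp]
  exact Trivialization.symmL_continuousLinearMapAt _ ((mem_baseSet_iff x₀ p).2 hp) v

/-- The change of coordinates from the chart around `x₀` to the chart around `x₁`. -/
def chartTransition (x₀ x₁ : M) : EuclideanSpace ℝ (Fin n) → EuclideanSpace ℝ (Fin n) :=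
  extChartAt (𝓡 n) x₁ ∘ (extChartAt (𝓡 n) x₀).symm

theorem contDiffAt_chartTransition {x₀ x₁ p : M} (h₀ : p ∈ (extChartAt (𝓡 n) x₀).source)
    (h₁ : p ∈ (extChartAt (𝓡 n) x₁).source) :
    ContDiffAt ℝ ∞ (chartTransition (n := n) x₀ x₁) (extChartAt (𝓡 n) x₀ p) := by
  have h := contDiffWithinAt_ext_coord_change (I := 𝓡 n) (n := ∞) x₁ x₀
    (y := extChartAt (𝓡 n) x₀ p) ((PartialEquiv.trans_source _ _).symm ▸
      ⟨(extChartAt (𝓡 n) x₀).map_source h₀, by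
        rwa [Set.mem_preimage, (extChartAt (𝓡 n) x₀).left_inv h₀]⟩)
  rwa [ModelWithCorners.range_eq_univ, contDiffWithinAt_univ] at h

/-- Tangent vectors at `p` are represented in the preferred chart at `p`, so this is the cocycle
identity from that chart through `x₀` to `x₁`. -/
theorem tangentCoord_eq_fderiv {x₀ x₁ p : M} (h₀ : p ∈ (extChartAt (𝓡 n) x₀).source)
    (h₁ : p ∈ (extChartAt (𝓡 n) x₁).source) (v : TangentSpace (𝓡 n) p) :
    tangentCoord x₁ p v = fderiv ℝ (chartTransition x₀ x₁) (extChartAt (𝓡 n) x₀ p)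
      (tangentCoord x₀ p v) := by
  have h := (tangentBundleCore (𝓡 n) M).coordChange_comp (achart _ p) (achart _ x₀) (achart _ x₁) p
    ⟨⟨mem_chart_source _ p, by simpa using h₀⟩, by simpa using h₁⟩ v
  rw [tangentBundleCore_coordChange_achart, ModelWithCorners.range_eq_univ, fderivWithin_univ] at h
  exact h.symm

variable [RiemannianBundle (fun x : M ↦ TangentSpace (𝓡 n) x)]

theorem matrixForm_metricMatrix (x₀ : M) (y v w : EuclideanSpace ℝ (Fin n)) :
    matrixForm (metricMatrix x₀ y) v w = inner ℝ
      ((trivializationAt (EuclideanSpace ℝ (Fin n)) (TangentSpace (𝓡 n)) x₀).symmL ℝ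
        ((extChartAt (𝓡 n) x₀).symm y) v)
      ((trivializationAt (EuclideanSpace ℝ (Fin n)) (TangentSpace (𝓡 n)) x₀).symmL ℝ
        ((extChartAt (𝓡 n) x₀).symm y) w) := by
  rw [matrixForm_apply]
  conv_rhs => rw [euclidean_eq_sum v, euclidean_eq_sum w]
  simp only [map_sum, map_smul, sum_inner, inner_sum, inner_smul_left, inner_smul_right,
    conj_trivial]
  rw [Finset.sum_comm]
  refine Finset.sum_congr rfl fun i _ ↦ ?_
  rw [Finset.mul_sum]
  refine Finset.sum_congr rfl fun j _ ↦ ?_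
  simp only [metricMatrix, Matrix.of_apply, coordVector]
  ring

theorem matrixForm_metricMatrix_tangentCoord (x₀ : M) {p : M}
    (hp : p ∈ (extChartAt (𝓡 n) x₀).source) (v w : TangentSpace (𝓡 n) p) :
    matrixForm (metricMatrix x₀ (extChartAt (𝓡 n) x₀ p)) (tangentCoord x₀ p v)
      (tangentCoord x₀ p w) = inner ℝ v w := by
  rw [matrixForm_metricMatrix, (extChartAt (𝓡 n) x₀).left_inv hp, symmL_tangentCoord x₀ hp,
    symmL_tangentCoord x₀ hp]

theorem metricMatrix_comm (x₀ : M) (y : EuclideanSpace ℝ (Fin n)) (i j : Fin n) :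
    metricMatrix x₀ y i j = metricMatrix x₀ y j i :=
  real_inner_comm (coordVector x₀ y j) (coordVector x₀ y i)

/-- A kernel vector would be the coordinates of a tangent vector of length zero. -/
theorem isUnit_det_metricMatrix (x₀ : M) {y : EuclideanSpace ℝ (Fin n)}
    (hy : y ∈ (extChartAt (𝓡 n) x₀).target) : IsUnit (metricMatrix x₀ y).det := by
  rw [isUnit_iff_ne_zero]
  intro h
  obtain ⟨v, hv, hv0⟩ := Matrix.exists_mulVec_eq_zero_iff.2 h
  have hform : matrixForm (metricMatrix x₀ y) (WithLp.toLp 2 v) (WithLp.toLp 2 v) = 0 := by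
    rw [matrixForm_apply]
    refine Finset.sum_eq_zero fun i _ ↦ ?_
    have hi := congrFun hv0 i
    simp only [Matrix.mulVec, dotProduct, Pi.zero_apply] at hi
    calc _ = v i * ∑ j, metricMatrix x₀ y i j * v j := by
          rw [Finset.mul_sum]
          exact Finset.sum_congr rfl fun j _ ↦ by ring
      _ = 0 := by rw [hi, mul_zero]
  rw [matrixForm_metricMatrix, inner_self_eq_zero] at hform
  have h2 := tangentCoord_symmL x₀ ((extChartAt (𝓡 n) x₀).map_target hy) (WithLp.toLp 2 v)
  rw [hform, tangentCoord_eq x₀ ((extChartAt (𝓡 n) x₀).map_target hy), map_zero] at h2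
  exact hv (by simpa using (congrArg WithLp.ofLp h2).symm)

variable [IsContMDiffRiemannianBundle (𝓡 n) ∞ (EuclideanSpace ℝ (Fin n))
  (fun x : M ↦ TangentSpace (𝓡 n) x)]

/-- The coordinate fields are constant in the trivialization, hence smooth, and the bundle metric is
smooth. -/
theorem contDiffAt_metricMatrix (x₀ : M) {y : EuclideanSpace ℝ (Fin n)}
    (hy : y ∈ (extChartAt (𝓡 n) x₀).target) (i j : Fin n) :
    ContDiffAt ℝ ∞ (fun z ↦ metricMatrix x₀ z i j) y := by
  rw [← contMDiffAt_iff_contDiffAt]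
  have hnhds : (extChartAt (𝓡 n) x₀).target ∈ 𝓝 y := (isOpen_extChartAt_target x₀).mem_nhds hy
  have key (i : Fin n) : ContMDiffAt 𝓘(ℝ, EuclideanSpace ℝ (Fin n))
      ((𝓡 n).prod 𝓘(ℝ, EuclideanSpace ℝ (Fin n))) ∞
      (fun z ↦ (⟨(extChartAt (𝓡 n) x₀).symm z, coordVector x₀ z i⟩ :
        TotalSpace (EuclideanSpace ℝ (Fin n)) (TangentSpace (𝓡 n) (M := M)))) y := by
    rw [(trivializationAt (EuclideanSpace ℝ (Fin n)) (TangentSpace (𝓡 n)) x₀).contMDiffAt_iff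
      (IB := 𝓡 n) ((Trivialization.mem_source _).2 (symm_mem_baseSet x₀ hy))]
    refine ⟨(contMDiffOn_extChartAt_symm x₀).contMDiffAt hnhds, ?_⟩
    refine (contMDiffAt_const (c := EuclideanSpace.single i (1 : ℝ))).congr_of_eventuallyEq ?_
    filter_upwards [hnhds] with z hz
    exact tangentCoord_symmL x₀ ((extChartAt (𝓡 n) x₀).map_target hz) _
  exact ContMDiffAt.inner_bundle (key i) (key j)

/-- The transition map is an isometry between the two metric matrices, since near `p` both compute
the same inner product on tangent spaces. -/
theorem fderiv_chartTransition_christoffelVec {x₀ x₁ p : M}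
    (h₀ : p ∈ (extChartAt (𝓡 n) x₀).source) (h₁ : p ∈ (extChartAt (𝓡 n) x₁).source)
    (u v : EuclideanSpace ℝ (Fin n)) :
    fderiv ℝ (chartTransition x₀ x₁) (extChartAt (𝓡 n) x₀ p)
        (christoffelVec (metricMatrix x₀) (extChartAt (𝓡 n) x₀ p) u v) =
      christoffelVec (metricMatrix x₁) (extChartAt (𝓡 n) x₁ p)
        (fderiv ℝ (chartTransition x₀ x₁) (extChartAt (𝓡 n) x₀ p) u)
        (fderiv ℝ (chartTransition x₀ x₁) (extChartAt (𝓡 n) x₀ p) v) +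
      fderiv ℝ (fderiv ℝ (chartTransition x₀ x₁)) (extChartAt (𝓡 n) x₀ p) u v := by
  have hy₀ : extChartAt (𝓡 n) x₀ p ∈ (extChartAt (𝓡 n) x₀).target :=
    (extChartAt (𝓡 n) x₀).map_source h₀
  have hy₁ : extChartAt (𝓡 n) x₁ p ∈ (extChartAt (𝓡 n) x₁).target :=
    (extChartAt (𝓡 n) x₁).map_source h₁
  have hφ : chartTransition x₀ x₁ (extChartAt (𝓡 n) x₀ p) = extChartAt (𝓡 n) x₁ p := by
    simp only [chartTransition, Function.comp_apply, (extChartAt (𝓡 n) x₀).left_inv h₀]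
  rw [← hφ] at hy₁ ⊢
  refine fderiv_christoffelVec ((contDiffAt_chartTransition h₀ h₁).of_le (by norm_cast))
    ?_ (fun i j ↦ (contDiffAt_metricMatrix x₀ hy₀ i j).differentiableAt (by simp))
    (metricMatrix_comm x₀ _) (isUnit_det_metricMatrix x₀ hy₀)
    (fun i j ↦ (contDiffAt_metricMatrix x₁ hy₁ i j).differentiableAt (by simp))
    (metricMatrix_comm x₁ _) (isUnit_det_metricMatrix x₁ hy₁) ?_ u v
  · intro w
    refine ⟨tangentCoord x₀ p ((trivializationAt (EuclideanSpace ℝ (Fin n)) (TangentSpace (𝓡 n))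
      x₁).symmL ℝ p w), ?_⟩
    rw [← tangentCoord_eq_fderiv h₀ h₁, tangentCoord_symmL x₁ h₁]
  · have hopen : (extChartAt (𝓡 n) x₀).target ∩
        (extChartAt (𝓡 n) x₀).symm ⁻¹' (extChartAt (𝓡 n) x₁).source ∈
        𝓝 (extChartAt (𝓡 n) x₀ p) := by
      refine ((continuousOn_extChartAt_symm x₀).isOpen_inter_preimage
        (isOpen_extChartAt_target x₀) (isOpen_extChartAt_source x₁)).mem_nhds ⟨hy₀, ?_⟩
      rw [Set.mem_preimage, (extChartAt (𝓡 n) x₀).left_inv h₀]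
      exact h₁
    filter_upwards [hopen] with z hz v w
    obtain ⟨q, hq, rfl⟩ : ∃ q ∈ (extChartAt (𝓡 n) x₀).source, extChartAt (𝓡 n) x₀ q = z :=
      ⟨_, (extChartAt (𝓡 n) x₀).map_target hz.1, (extChartAt (𝓡 n) x₀).right_inv hz.1⟩
    have hq₁ : q ∈ (extChartAt (𝓡 n) x₁).source := by
      simpa only [Set.mem_preimage, (extChartAt (𝓡 n) x₀).left_inv hq] using hz.2
    obtain ⟨v, rfl⟩ : ∃ v', tangentCoord x₀ q v' = v := ⟨_, tangentCoord_symmL x₀ hq v⟩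
    obtain ⟨w, rfl⟩ : ∃ w', tangentCoord x₀ q w' = w := ⟨_, tangentCoord_symmL x₀ hq w⟩
    rw [← tangentCoord_eq_fderiv hq hq₁, ← tangentCoord_eq_fderiv hq hq₁,
      matrixForm_metricMatrix_tangentCoord x₀ hq]
    simp only [chartTransition, Function.comp_apply, (extChartAt (𝓡 n) x₀).left_inv hq]
    rw [matrixForm_metricMatrix_tangentCoord x₁ hq₁]

end Metric

/-! ### Derivatives within the parameter set. -/

section Calculus

theorem contDiffWithinAt_derivWithin {F : Type*} [NormedAddCommGroup F] [NormedSpace ℝ F]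
    {J : Set ℝ} {t : ℝ} {f : ℝ → F} {m : ℕ} (hf : ContDiffWithinAt ℝ (m + 1 : ℕ) f J t) (hJ : UniqueDiffOn ℝ J)
    (ht : t ∈ J) : ContDiffWithinAt ℝ m (derivWithin f J) J t := by
  have h : ContDiffWithinAt ℝ m (fderivWithin ℝ f J) J t :=
    hf.fderivWithin_right hJ (by norm_cast) ht
  exact (h.clm_apply (contDiffWithinAt_const (c := (1 : ℝ)))).congr
    (fun _ _ ↦ rfl) rfl

/-- The second-derivative term is the one that the Christoffel symbols must compensate. -/
theorem hasDerivWithinAt_fderiv_comp {F : Type*} [NormedAddCommGroup F] [NormedSpace ℝ F]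
    {J : Set ℝ} {t : ℝ} {φ : F → F} {x v : ℝ → F} {x' v' : F} (hφ : ContDiffAt ℝ 2 φ (x t))
    (hx : HasDerivWithinAt x x' J t) (hv : HasDerivWithinAt v v' J t) :
    HasDerivWithinAt (fun s ↦ fderiv ℝ φ (x s) (v s))
      (fderiv ℝ (fderiv ℝ φ) (x t) x' (v t) + fderiv ℝ φ (x t) v') J t := by
  have h : HasFDerivAt (fderiv ℝ φ) (fderiv ℝ (fderiv ℝ φ) (x t)) (x t) :=
    ((hφ.fderiv_right (m := 1) (by norm_num)).differentiableAt one_ne_zero).hasFDerivAt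
  exact (h.comp_hasDerivWithinAt t hx).clm_apply hv

end Calculus

/-! ### Covariant differentiation along a curve. -/

section Curve

theorem eventually_mem_source {n : ℕ} {M : Type*} [TopologicalSpace M]
    [ChartedSpace (EuclideanSpace ℝ (Fin n)) M] {J : Set ℝ} {c : ℝ → M} {t : ℝ}
    (hc : ContinuousWithinAt c J t) {x₀ : M}
    (h₀ : c t ∈ (extChartAt (𝓡 n) x₀).source) :
    ∀ᶠ s in 𝓝[J] t, c s ∈ (extChartAt (𝓡 n) x₀).source :=
  hc.eventually ((isOpen_extChartAt_source x₀).mem_nhds h₀)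

variable {n : ℕ} {M : Type*} [TopologicalSpace M] [ChartedSpace (EuclideanSpace ℝ (Fin n)) M]
  [IsManifold (𝓡 n) ∞ M] {J : Set ℝ} {c : ℝ → M} {t : ℝ}

theorem contDiffWithinAt_extChartAt_comp {m : ℕ} (hc : ContMDiffOn 𝓘(ℝ, ℝ) (𝓡 n) m c J)
    (ht : t ∈ J) {x₀ : M} (h₀ : c t ∈ (extChartAt (𝓡 n) x₀).source) :
    ContDiffWithinAt ℝ m (fun s ↦ extChartAt (𝓡 n) x₀ (c s)) J t := by
  rw [← contMDiffWithinAt_iff_contDiffWithinAt]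
  exact (contMDiffAt_extChartAt' (by simpa using h₀)).comp_contMDiffWithinAt t (hc t ht)

theorem tangentCoord_velocity (hc : MDifferentiableWithinAt 𝓘(ℝ, ℝ) (𝓡 n) c J t)
    (hJ : UniqueDiffWithinAt ℝ J t) {x₀ : M} (h₀ : c t ∈ (extChartAt (𝓡 n) x₀).source) :
    tangentCoord x₀ (c t) (velocity n J c t) =
      derivWithin (fun s ↦ extChartAt (𝓡 n) x₀ (c s)) J t := by
  have h₀' : c t ∈ (chartAt (EuclideanSpace ℝ (Fin n)) x₀).source := by simpa using h₀
  rw [tangentCoord_eq x₀ h₀, TangentBundle.continuousLinearMapAt_trivializationAt h₀', velocity,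
    ← fderivWithin_derivWithin, ← mfderivWithin_eq_fderivWithin]
  have h := mfderiv_comp_mfderivWithin t (mdifferentiableAt_extChartAt (I := 𝓡 n) h₀') hc
    hJ.uniqueMDiffWithinAt
  exact (congrArg (fun L ↦ L (1 : ℝ)) h).symm

/-- The field `V` along `c : J → M` is of class `C^m`. -/
def ContDiffAlong (J : Set ℝ) (c : ℝ → M) (m : ℕ) (V : ∀ t, TangentSpace (𝓡 n) (c t)) : Prop :=
  ∀ x₀ : M, ∀ t ∈ J, c t ∈ (extChartAt (𝓡 n) x₀).source →
    ContDiffWithinAt ℝ m (fun s ↦ tangentCoord x₀ (c s) (V s)) J t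

theorem ContDiffAlong.velocity {m : ℕ} (hc : ContMDiffOn 𝓘(ℝ, ℝ) (𝓡 n) (m + 1 : ℕ) c J)
    (hJ : UniqueDiffOn ℝ J) : ContDiffAlong J c m (velocity n J c) := by
  intro x₀ t ht h₀
  refine (contDiffWithinAt_derivWithin (contDiffWithinAt_extChartAt_comp hc ht h₀) hJ
    ht).congr_of_eventuallyEq_of_mem ?_ ht
  filter_upwards [eventually_mem_source (hc.continuousOn t ht) h₀, self_mem_nhdsWithin] with s hs hsJ
  exact tangentCoord_velocity ((hc s hsJ).mdifferentiableWithinAt (by simp)) (hJ s hsJ) hs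

variable [RiemannianBundle (fun x : M ↦ TangentSpace (𝓡 n) x)]

/-- The coordinates of the covariant derivative of `V` along `c` in the chart around `x₀`. -/
def covCoord (x₀ : M) (J : Set ℝ) (c : ℝ → M) (V : ∀ t, TangentSpace (𝓡 n) (c t)) (t : ℝ) :
    EuclideanSpace ℝ (Fin n) :=
  derivWithin (fun s ↦ tangentCoord x₀ (c s) (V s)) J t +
    christoffelVec (metricMatrix x₀) (extChartAt (𝓡 n) x₀ (c t))
      (derivWithin (fun s ↦ extChartAt (𝓡 n) x₀ (c s)) J t) (tangentCoord x₀ (c t) (V t))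

theorem covDeriv_eq (V : ∀ t, TangentSpace (𝓡 n) (c t)) : covDeriv n J c V t =
    (trivializationAt (EuclideanSpace ℝ (Fin n)) (TangentSpace (𝓡 n)) (c t)).symmL ℝ (c t)
      (covCoord (c t) J c V t) := rfl

/-- The field `V` along `c` is differentiable at `t`, with covariant derivative `D`. -/
def HasCovDerivAt (J : Set ℝ) (c : ℝ → M) (V : ∀ t, TangentSpace (𝓡 n) (c t)) (t : ℝ)
    (D : TangentSpace (𝓡 n) (c t)) : Prop :=
  DifferentiableWithinAt ℝ (fun s ↦ tangentCoord (c t) (c s) (V s)) J t ∧ covDeriv n J c V t = D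

/-- Derivatives are taken within `J`, so agreement on `J` suffices; formulas for the frame are
available only there. -/
theorem HasCovDerivAt.congr {V W : ∀ t, TangentSpace (𝓡 n) (c t)} {D : TangentSpace (𝓡 n) (c t)}
    (hV : HasCovDerivAt J c V t D) (ht : t ∈ J) (h : ∀ s ∈ J, W s = V s) :
    HasCovDerivAt J c W t D := by
  have h' : ∀ s ∈ J, tangentCoord (c t) (c s) (W s) = tangentCoord (c t) (c s) (V s) :=
    fun s hs ↦ by rw [h s hs]
  refine ⟨hV.1.congr h' (h' t ht), ?_⟩
  rw [← hV.2, covDeriv_eq, covDeriv_eq, covCoord, covCoord, derivWithin_congr h' (h' t ht), h t ht]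

theorem HasCovDerivAt.add (hc : ContinuousWithinAt c J t) (ht : t ∈ J)
    {V W : ∀ t, TangentSpace (𝓡 n) (c t)} {D D' : TangentSpace (𝓡 n) (c t)}
    (hV : HasCovDerivAt J c V t D) (hW : HasCovDerivAt J c W t D') :
    HasCovDerivAt J c (fun s ↦ V s + W s) t (D + D') := by
  have h : ∀ᶠ s in 𝓝[J] t, tangentCoord (c t) (c s) (V s + W s) =
      tangentCoord (c t) (c s) (V s) + tangentCoord (c t) (c s) (W s) := by
    filter_upwards [eventually_mem_source (n := n) hc (mem_extChartAt_source (c t))] with s hs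
    simp only [tangentCoord_eq _ hs, map_add]
  have ht' := h.self_of_nhdsWithin ht
  refine ⟨(hV.1.add hW.1).congr_of_eventuallyEq h ht', ?_⟩
  rw [← hV.2, ← hW.2, covDeriv_eq, covDeriv_eq, covDeriv_eq, ← map_add]
  congr 1
  simp only [covCoord]
  rw [Filter.EventuallyEq.derivWithin_eq h ht', ht', christoffelVec_add,
    derivWithin_fun_add hV.1 hW.1]
  abel

/-- The Christoffel term is pointwise linear in `V`, so `a'` arises only from the ordinary
derivative. -/
theorem HasCovDerivAt.smul (hc : ContinuousWithinAt c J t) (ht : t ∈ J)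
    {V : ∀ t, TangentSpace (𝓡 n) (c t)} {D : TangentSpace (𝓡 n) (c t)}
    (hV : HasCovDerivAt J c V t D) {a : ℝ → ℝ} (ha : DifferentiableWithinAt ℝ a J t) :
    HasCovDerivAt J c (fun s ↦ a s • V s) t (a t • D + derivWithin a J t • V t) := by
  have h : ∀ᶠ s in 𝓝[J] t, tangentCoord (c t) (c s) (a s • V s) =
      a s • tangentCoord (c t) (c s) (V s) := by
    filter_upwards [eventually_mem_source (n := n) hc (mem_extChartAt_source (c t))] with s hs
    simp only [tangentCoord_eq _ hs, map_smul]
  have ht' := h.self_of_nhdsWithin ht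
  refine ⟨(ha.smul hV.1).congr_of_eventuallyEq h ht', ?_⟩
  rw [← hV.2, covDeriv_eq, covDeriv_eq]
  conv_rhs => rw [← symmL_tangentCoord (c t) (mem_extChartAt_source (c t)) (V t), ← map_smul,
    ← map_smul, ← map_add]
  congr 1
  simp only [covCoord]
  rw [Filter.EventuallyEq.derivWithin_eq h ht', ht', christoffelVec_smul,
    derivWithin_fun_smul ha hV.1, smul_add]
  abel

theorem HasCovDerivAt.neg (hc : ContinuousWithinAt c J t) (ht : t ∈ J)
    {V : ∀ t, TangentSpace (𝓡 n) (c t)} {D : TangentSpace (𝓡 n) (c t)}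
    (hV : HasCovDerivAt J c V t D) : HasCovDerivAt J c (fun s ↦ -V s) t (-D) := by
  simpa using hV.smul hc ht (differentiableWithinAt_const (-1 : ℝ))

theorem HasCovDerivAt.sum (hc : ContinuousWithinAt c J t) (ht : t ∈ J) {ι : Type*} (S : Finset ι)
    {V : ι → ∀ t, TangentSpace (𝓡 n) (c t)} {D : ι → TangentSpace (𝓡 n) (c t)}
    (hV : ∀ i ∈ S, HasCovDerivAt J c (V i) t (D i)) :
    HasCovDerivAt J c (fun s ↦ ∑ i ∈ S, V i s) t (∑ i ∈ S, D i) := by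
  classical
  induction S using Finset.induction_on with
  | empty =>
    have h : ∀ᶠ s in 𝓝[J] t,
        tangentCoord (c t) (c s) (0 : TangentSpace (𝓡 n) (c s)) = 0 := by
      filter_upwards [eventually_mem_source (n := n) hc (mem_extChartAt_source (c t))] with s hs
      rw [tangentCoord_eq _ hs, map_zero]
    have ht' := h.self_of_nhdsWithin ht
    simp only [Finset.sum_empty]
    refine ⟨(differentiableWithinAt_const (0 : EuclideanSpace ℝ (Fin n))).congr_of_eventuallyEq
      h ht', ?_⟩
    have h0 := christoffelVec_smul (G := metricMatrix (c t)) (y := extChartAt (𝓡 n) (c t) (c t)) 0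
      (derivWithin (fun s ↦ extChartAt (𝓡 n) (c t) (c s)) J t) 0
    rw [zero_smul, zero_smul] at h0
    rw [covDeriv_eq, covCoord, Filter.EventuallyEq.derivWithin_eq h ht', ht', h0]
    simp
  | insert i S hi ih =>
    simp only [Finset.sum_insert hi]
    exact (hV i (Finset.mem_insert_self i S)).add hc ht
      (ih fun j hj ↦ hV j (Finset.mem_insert_of_mem hj))

variable [IsContMDiffRiemannianBundle (𝓡 n) ∞ (EuclideanSpace ℝ (Fin n))
  (fun x : M ↦ TangentSpace (𝓡 n) x)]

/-- This serves to differentiate the Gram-Schmidt coefficients and norms; the value of the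
derivative never matters. -/
theorem differentiableWithinAt_inner (hc : MDifferentiableWithinAt 𝓘(ℝ, ℝ) (𝓡 n) c J t)
    {V W : ∀ t, TangentSpace (𝓡 n) (c t)} {D D' : TangentSpace (𝓡 n) (c t)}
    (hV : HasCovDerivAt J c V t D) (hW : HasCovDerivAt J c W t D') :
    DifferentiableWithinAt ℝ (fun s ↦ inner ℝ (V s) (W s)) J t := by
  have key {V : ∀ t, TangentSpace (𝓡 n) (c t)} {D : TangentSpace (𝓡 n) (c t)}
      (hV : HasCovDerivAt J c V t D) : MDifferentiableWithinAt 𝓘(ℝ, ℝ)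
      ((𝓡 n).prod 𝓘(ℝ, EuclideanSpace ℝ (Fin n)))
      (fun s ↦ (⟨c s, V s⟩ : TotalSpace (EuclideanSpace ℝ (Fin n))
        (TangentSpace (𝓡 n) (M := M)))) J t := by
    rw [mdifferentiableWithinAt_totalSpace]
    exact ⟨hc, hV.1.mdifferentiableWithinAt⟩
  have h := MDifferentiableWithinAt.inner_bundle (key hV) (key hW)
  exact h.differentiableWithinAt

/-- The coordinates of the covariant derivative transform like those of a tangent vector. -/
theorem covCoord_eq_fderiv (hc : ContinuousWithinAt c J t) (ht : t ∈ J)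
    (hJ : UniqueDiffWithinAt ℝ J t) {x₀ x₁ : M} (h₀ : c t ∈ (extChartAt (𝓡 n) x₀).source)
    (h₁ : c t ∈ (extChartAt (𝓡 n) x₁).source)
    (hx : DifferentiableWithinAt ℝ (fun s ↦ extChartAt (𝓡 n) x₀ (c s)) J t)
    {V : ∀ t, TangentSpace (𝓡 n) (c t)}
    (hV : DifferentiableWithinAt ℝ (fun s ↦ tangentCoord x₀ (c s) (V s)) J t) :
    covCoord x₁ J c V t = fderiv ℝ (chartTransition x₀ x₁) (extChartAt (𝓡 n) x₀ (c t))
      (covCoord x₀ J c V t) := by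
  have hφ := contDiffAt_chartTransition h₀ h₁
  have hφ1 : HasFDerivAt (chartTransition (n := n) x₀ x₁)
      (fderiv ℝ (chartTransition x₀ x₁) (extChartAt (𝓡 n) x₀ (c t))) (extChartAt (𝓡 n) x₀ (c t)) :=
    (hφ.differentiableAt (by simp)).hasFDerivAt
  have hev := (eventually_mem_source hc h₀).and (eventually_mem_source hc h₁)
  have hxe : (fun s ↦ extChartAt (𝓡 n) x₁ (c s)) =ᶠ[𝓝[J] t]
      (fun s ↦ chartTransition x₀ x₁ (extChartAt (𝓡 n) x₀ (c s))) := by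
    filter_upwards [hev] with s hs
    simp only [chartTransition, Function.comp_apply, (extChartAt (𝓡 n) x₀).left_inv hs.1]
  have hve : (fun s ↦ tangentCoord x₁ (c s) (V s)) =ᶠ[𝓝[J] t]
      (fun s ↦ fderiv ℝ (chartTransition x₀ x₁) (extChartAt (𝓡 n) x₀ (c s))
        (tangentCoord x₀ (c s) (V s))) := by
    filter_upwards [hev] with s hs using tangentCoord_eq_fderiv hs.1 hs.2 (V s)
  have hx' := hφ1.comp_hasDerivWithinAt t hx.hasDerivWithinAt
  have hv' := hasDerivWithinAt_fderiv_comp (x := fun s ↦ extChartAt (𝓡 n) x₀ (c s))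
    (hφ.of_le (by norm_cast)) hx.hasDerivWithinAt hV.hasDerivWithinAt
  have e1 : derivWithin (fun s ↦ extChartAt (𝓡 n) x₁ (c s)) J t =
      fderiv ℝ (chartTransition x₀ x₁) (extChartAt (𝓡 n) x₀ (c t))
        (derivWithin (fun s ↦ extChartAt (𝓡 n) x₀ (c s)) J t) :=
    (hx'.congr_of_eventuallyEq hxe (hxe.self_of_nhdsWithin ht)).derivWithin hJ
  have e2 := (hv'.congr_of_eventuallyEq hve (hve.self_of_nhdsWithin ht)).derivWithin hJ
  -- The second derivative of the transition map in `e2` matches the one in the Christoffel law.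
  rw [covCoord, covCoord, e1, e2, map_add, fderiv_chartTransition_christoffelVec h₀ h₁,
    tangentCoord_eq_fderiv h₀ h₁]
  abel

theorem ContDiffAlong.covDeriv {m : ℕ} (hc : ContMDiffOn 𝓘(ℝ, ℝ) (𝓡 n) (m + 1 : ℕ) c J)
    (hJ : UniqueDiffOn ℝ J) {V : ∀ t, TangentSpace (𝓡 n) (c t)}
    (hV : ContDiffAlong J c (m + 1) V) : ContDiffAlong J c m (covDeriv n J c V) := by
  intro x₀ t ht h₀
  have hx := contDiffWithinAt_extChartAt_comp hc ht h₀
  have hv := hV x₀ t ht h₀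
  have hcov : ContDiffWithinAt ℝ m (covCoord x₀ J c V) J t := by
    refine (contDiffWithinAt_derivWithin hv hJ ht).add ?_
    rw [contDiffWithinAt_euclidean]
    intro k
    simp only [christoffelVec]
    refine ContDiffWithinAt.sum fun i _ ↦ ContDiffWithinAt.sum fun j _ ↦ ?_
    have hy := (extChartAt (𝓡 n) x₀).map_source h₀
    have hΓ : ContDiffAt ℝ m (fun z ↦ matrixChristoffel (metricMatrix x₀) z k i j)
        (extChartAt (𝓡 n) x₀ (c t)) :=
      (contDiffAt_matrixChristoffel (contDiffAt_metricMatrix x₀ hy)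
        (isUnit_det_metricMatrix x₀ hy).ne_zero k i j).of_le (by norm_cast; exact le_top)
    refine ((hΓ.comp_contDiffWithinAt t (hx.of_le (by norm_cast; omega))).mul ?_).mul ?_
    · exact contDiffWithinAt_euclidean.1 (contDiffWithinAt_derivWithin hx hJ ht) i
    · exact contDiffWithinAt_euclidean.1 (hv.of_le (by norm_cast; omega)) j
  -- `hcov` concerns the fixed chart at `x₀`, while `covDeriv` at `s` uses the chart at `c s`; the
  -- change of chart identifies the two.
  refine hcov.congr_of_eventuallyEq_of_mem ?_ ht
  filter_upwards [eventually_mem_source (hc.continuousOn t ht) h₀, self_mem_nhdsWithin] with s hs hsJ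
  have hs' : c s ∈ (extChartAt (𝓡 n) (c s)).source := mem_extChartAt_source (c s)
  rw [covCoord_eq_fderiv (hc.continuousOn s hsJ) hsJ (hJ s hsJ) hs' hs
    ((contDiffWithinAt_extChartAt_comp hc hsJ hs').differentiableWithinAt (by simp))
    ((hV (c s) s hsJ hs').differentiableWithinAt (by simp)), tangentCoord_eq_fderiv hs' hs,
    covDeriv_eq, tangentCoord_symmL (c s) hs']

/-- `curveDeriv n J c k` is `c^{(k+1)}`, so it consumes `k + 1` of the `n` available derivatives. -/
theorem contDiffAlong_curveDeriv (hc : ContMDiffOn 𝓘(ℝ, ℝ) (𝓡 n) n c J) (hJ : UniqueDiffOn ℝ J)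
    (k m : ℕ) (h : k + m + 1 ≤ n) : ContDiffAlong J c m (curveDeriv n J c k) := by
  induction k generalizing m with
  | zero => exact ContDiffAlong.velocity (hc.of_le (by norm_cast; omega)) hJ
  | succ k ih =>
    exact ContDiffAlong.covDeriv (hc.of_le (by norm_cast; omega)) hJ (ih (m + 1) (by omega))

theorem hasCovDerivAt_curveDeriv (hc : ContMDiffOn 𝓘(ℝ, ℝ) (𝓡 n) n c J) (hJ : UniqueDiffOn ℝ J)
    (ht : t ∈ J) {k : ℕ} (hk : k + 2 ≤ n) :
    HasCovDerivAt J c (curveDeriv n J c k) t (curveDeriv n J c (k + 1) t) :=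
  ⟨(contDiffAlong_curveDeriv hc hJ k 1 hk (c t) t ht (mem_extChartAt_source (c t))
    ).differentiableWithinAt one_ne_zero, rfl⟩

end Curve

/-! ### The Frenet frame and its curvatures. -/

section Frenet

open InnerProductSpace

variable {n : ℕ} {M : Type*} [TopologicalSpace M] [ChartedSpace (EuclideanSpace ℝ (Fin n)) M]
  [IsManifold (𝓡 n) ∞ M] [RiemannianBundle (fun x : M ↦ TangentSpace (𝓡 n) x)]
  {J : Set ℝ} {c : ℝ → M} {t : ℝ}

variable (n) in
/-- The Gram-Schmidt orthogonalization of the consecutive covariant derivatives of the curve. -/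
def orthoDeriv (J : Set ℝ) (c : ℝ → M) (k : ℕ) (t : ℝ) : TangentSpace (𝓡 n) (c t) :=
  gramSchmidt ℝ (fun i ↦ curveDeriv n J c i t) k

theorem IsRegularCurve.orthoDeriv_ne_zero (hc : IsRegularCurve n J c) (ht : t ∈ J) {k : ℕ}
    (hk : k + 1 < n) : orthoDeriv n J c k t ≠ 0 :=
  gramSchmidt_ne_zero_of_linearIndependent (fun i ↦ curveDeriv n J c i t) (k := n - 1)
    (hc.linearIndependent t ht) (by omega)

theorem frenetFrame_eq (o : ManifoldOrientation n M) (hc : IsRegularCurve n J c) (ht : t ∈ J)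
    {k : ℕ} (hk : k + 1 < n) : frenetFrame o J c ⟨k, by omega⟩ t =
      ‖orthoDeriv n J c k t‖⁻¹ • orthoDeriv n J c k t :=
  positiveFrame_eq (i := ⟨k, by omega⟩) (o.orient (c t)) (fun i ↦ curveDeriv n J c i t) hk
    (hc.orthoDeriv_ne_zero ht hk)

variable [IsContMDiffRiemannianBundle (𝓡 n) ∞ (EuclideanSpace ℝ (Fin n))
  (fun x : M ↦ TangentSpace (𝓡 n) x)]

/-- Differentiate `w_k = c^{(k+1)} - ∑ a_i w_i` over `i < k`. By strong induction each `D w_i`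
involves `curveDeriv` only up to index `i + 1 ≤ k`, so the whole sum stays in the span. -/
theorem hasCovDerivAt_orthoDeriv (hc : IsRegularCurve n J c) (hJ : UniqueDiffOn ℝ J) (ht : t ∈ J)
    {k : ℕ} (hk : k + 1 < n) :
    ∃ d ∈ Submodule.span ℝ ((fun i ↦ curveDeriv n J c i t) '' Set.Iic k),
      HasCovDerivAt J c (orthoDeriv n J c k) t (curveDeriv n J c (k + 1) t + d) := by
  have hcont := hc.contMDiffOn.continuousOn t ht
  have hmd : MDifferentiableWithinAt 𝓘(ℝ, ℝ) (𝓡 n) c J t :=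
    (hc.contMDiffOn t ht).mdifferentiableWithinAt (by norm_cast; omega)
  induction k using Nat.strong_induction_on with
  | _ k ih =>
    let S := Submodule.span ℝ ((fun i ↦ curveDeriv n J c i t) '' Set.Iic k)
    have hmono {i : ℕ} (hi : i ≤ k) :
        Submodule.span ℝ ((fun i ↦ curveDeriv n J c i t) '' Set.Iic i) ≤ S :=
      Submodule.span_mono (Set.image_mono (Set.Iic_subset_Iic.2 hi))
    have hmem {i : ℕ} (hi : i ≤ k) : curveDeriv n J c i t ∈ S :=
      Submodule.subset_span ⟨i, hi, rfl⟩
    let a : ℕ → ℝ → ℝ := fun i s ↦ inner ℝ (orthoDeriv n J c i s) (curveDeriv n J c k s) /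
      inner ℝ (orthoDeriv n J c i s) (orthoDeriv n J c i s)
    have hk' := hasCovDerivAt_curveDeriv hc.contMDiffOn hJ ht (k := k) (by omega)
    -- Stated for all `i`, with `0` chosen for `i ≥ k`, so that `choose` yields a total family in
    -- `S`.
    have hterm (i : ℕ) : ∃ D ∈ S, i ∈ Finset.Iio k →
        HasCovDerivAt J c (fun s ↦ a i s • orthoDeriv n J c i s) t D := by
      by_cases hi : i < k
      · obtain ⟨d, hd, hD⟩ := ih i hi (by omega)
        have ha : DifferentiableWithinAt ℝ (a i) J t :=
          (differentiableWithinAt_inner hmd hD hk').div (differentiableWithinAt_inner hmd hD hD)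
            (inner_self_ne_zero.2 (hc.orthoDeriv_ne_zero ht (by omega)))
        refine ⟨_, ?_, fun _ ↦ hD.smul hcont ht ha⟩
        exact S.add_mem (S.smul_mem _ (S.add_mem (hmem hi) (hmono hi.le hd)))
          (S.smul_mem _ (hmono hi.le (gramSchmidt_mem_span ℝ _ le_rfl)))
      · exact ⟨0, S.zero_mem, fun h ↦ absurd (Finset.mem_Iio.1 h) hi⟩
    choose D hDS hD using hterm
    refine ⟨-∑ i ∈ Finset.Iio k, D i, S.neg_mem (S.sum_mem fun i _ ↦ hDS i), ?_⟩
    refine (hk'.add hcont ht ((HasCovDerivAt.sum hcont ht _ hD).neg hcont ht)).congr ht ?_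
    intro s _
    rw [← sub_eq_add_neg, eq_sub_iff_add_eq]
    have h := gramSchmidt_def'' ℝ (fun i ↦ curveDeriv n J c i s) k
    simp only [a, real_inner_self_eq_norm_sq]
    exact h.symm

/-- The frame vector of index `k + 1` is orthogonal to `curveDeriv` of index at most `k`. This
removes both the derivative of the factor `‖w_k‖⁻¹`, which multiplies `w_k`, and the remainder `d`.
The argument includes the case where `k + 1` is the last index. -/
theorem inner_covDeriv_frenetFrame (o : ManifoldOrientation n M) (hc : IsRegularCurve n J c)
    (hJ : UniqueDiffOn ℝ J) (ht : t ∈ J) {k : ℕ} (hk : k + 1 < n) :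
    inner ℝ (covDeriv n J c (frenetFrame o J c ⟨k, by omega⟩) t)
        (frenetFrame o J c ⟨k + 1, hk⟩ t) =
      ‖orthoDeriv n J c k t‖⁻¹ *
        inner ℝ (frenetFrame o J c ⟨k + 1, hk⟩ t) (curveDeriv n J c (k + 1) t) := by
  have hcont := hc.contMDiffOn.continuousOn t ht
  have hmd : MDifferentiableWithinAt 𝓘(ℝ, ℝ) (𝓡 n) c J t :=
    (hc.contMDiffOn t ht).mdifferentiableWithinAt (by norm_cast; omega)
  obtain ⟨d, hd, hD⟩ := hasCovDerivAt_orthoDeriv hc hJ ht hk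
  have hinner : DifferentiableWithinAt ℝ (fun s ↦ ‖orthoDeriv n J c k s‖⁻¹) J t := by
    have h := differentiableWithinAt_inner hmd hD hD
    have h2 := (h.sqrt (inner_self_ne_zero.2 (hc.orthoDeriv_ne_zero ht hk))).inv (by
      rw [← norm_eq_sqrt_real_inner]
      exact norm_ne_zero_iff.2 (hc.orthoDeriv_ne_zero ht hk))
    exact h2.congr_of_eventuallyEq_of_mem (Filter.Eventually.of_forall fun s ↦ congrArg (·⁻¹)
      (norm_eq_sqrt_real_inner (orthoDeriv n J c k s))) ht
  have he := ((hD.smul hcont ht hinner).congr ht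
    fun s hs ↦ frenetFrame_eq o hc hs hk).2
  have horth : ∀ x ∈ Submodule.span ℝ ((fun i ↦ curveDeriv n J c i t) '' Set.Iic k),
      inner ℝ (frenetFrame o J c ⟨k + 1, hk⟩ t) x = 0 := by
    intro x hx
    induction hx using Submodule.span_induction with
    | mem x hx =>
      obtain ⟨i, hi, rfl⟩ := hx
      exact inner_positiveFrame_eq_zero (o.orient (c t))
        (fun j : Fin n ↦ curveDeriv n J c (j : ℕ) t) (i := ⟨k + 1, hk⟩)
        (j := ⟨i, (Nat.lt_succ_of_le hi).trans hk⟩) (Nat.lt_succ_of_le hi)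
    | zero => exact inner_zero_right _
    | add x y _ _ hx hy => rw [inner_add_right, hx, hy, add_zero]
    | smul a x _ hx => rw [inner_smul_right, hx, mul_zero]
  have hW : inner ℝ (frenetFrame o J c ⟨k + 1, hk⟩ t) (orthoDeriv n J c k t) = 0 :=
    horth _ (gramSchmidt_mem_span ℝ _ le_rfl)
  rw [he, real_inner_comm, inner_add_right, inner_smul_right, inner_smul_right, inner_add_right,
    horth d hd, hW, mul_zero, add_zero, add_zero]

theorem curvature_succ (o : ManifoldOrientation n M) (hc : IsRegularCurve n J c)
    (hJ : UniqueDiffOn ℝ J) (ht : t ∈ J) {k : ℕ} (hk : k + 1 < n) :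
    curvature o J c (k + 1) hk t = ‖orthoDeriv n J c k t‖⁻¹ *
      inner ℝ (frenetFrame o J c ⟨k + 1, hk⟩ t) (curveDeriv n J c (k + 1) t) *
      ‖velocity n J c t‖⁻¹ := by
  rw [← inner_covDeriv_frenetFrame o hc hJ ht hk, ← div_eq_mul_inv]
  rfl

end Frenet

end FrenetSerret

end

/-! ### The curvature formulas. -/

theorem mainTheorem3 {n : ℕ} (hn : 2 ≤ n) {M : Type*} [TopologicalSpace M]
    [ChartedSpace (EuclideanSpace ℝ (Fin n)) M] [IsManifold (𝓡 n) ∞ M]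
    [RiemannianBundle (fun x : M ↦ TangentSpace (𝓡 n) x)]
    [IsContMDiffRiemannianBundle (𝓡 n) ∞ (EuclideanSpace ℝ (Fin n))
      (fun x : M ↦ TangentSpace (𝓡 n) x)]
    (o : FrenetSerret.ManifoldOrientation n M)
    (J : Set ℝ) (hJ : J.OrdConnected) (hJ' : J.Nontrivial)
    (c : ℝ → M) (hc : FrenetSerret.IsRegularCurve n J c) (t : ℝ) (ht : t ∈ J) :
    (∀ (r : ℕ) (_ : 1 ≤ r) (hr : r ≤ n - 2),
      FrenetSerret.curvature o J c r (by omega) t =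
        FrenetSerret.curveVolume n J c (r - 1) t * FrenetSerret.curveVolume n J c (r + 1) t /
          FrenetSerret.curveVolume n J c r t ^ 2 * ‖FrenetSerret.velocity n J c t‖⁻¹) ∧
    FrenetSerret.curvature o J c (n - 1) (by omega) t =
      FrenetSerret.curveVolume n J c (n - 2) t * FrenetSerret.curveDet o J c t /
        FrenetSerret.curveVolume n J c (n - 1) t ^ 2 * ‖FrenetSerret.velocity n J c t‖⁻¹ := by
  -- A nontrivial interval is convex with nonempty interior, so derivatives within it are unique,
  -- endpoints included.
  have hJu : UniqueDiffOn ℝ J :=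
    uniqueDiffOn_convex hJ.convex (hJ.convex.nontrivial_iff_nonempty_interior.1 hJ')
  have hvol (k : ℕ) : FrenetSerret.curveVolume n J c k t =
      ∏ i ∈ Finset.range k, ‖FrenetSerret.orthoDeriv n J c i t‖ :=
    FrenetSerret.kVolume_eq_prod (fun i ↦ FrenetSerret.curveDeriv n J c i t) k
  have hne {i : ℕ} (hi : i + 1 < n) : ‖FrenetSerret.orthoDeriv n J c i t‖ ≠ 0 :=
    norm_ne_zero_iff.2 (hc.orthoDeriv_ne_zero ht hi)
  have hvne {k : ℕ} (hk : k < n) :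
      ∏ i ∈ Finset.range k, ‖FrenetSerret.orthoDeriv n J c i t‖ ≠ 0 :=
    Finset.prod_ne_zero_iff.2 fun i hi ↦ hne (by have := Finset.mem_range.1 hi; omega)
  constructor
  · intro r hr1 hr
    obtain ⟨k, rfl⟩ : ∃ k, r = k + 1 := ⟨r - 1, by omega⟩
    have h0 := hne (i := k) (by omega)
    have h1 := hne (i := k + 1) (by omega)
    have hv := hvne (k := k) (by omega)
    have hin : inner ℝ (FrenetSerret.orthoDeriv n J c (k + 1) t)
        (FrenetSerret.curveDeriv n J c (k + 1) t) =
        ‖FrenetSerret.orthoDeriv n J c (k + 1) t‖ ^ 2 :=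
      FrenetSerret.inner_gramSchmidt_self (fun i ↦ FrenetSerret.curveDeriv n J c i t) (k + 1)
    -- Since `r ≤ n - 2`, the frame vector of index `k + 1` is still a normalized Gram-Schmidt
    -- vector, and both sides reduce to `‖w_{k+1}‖ / ‖w_k‖` times `‖c'‖⁻¹`.
    rw [FrenetSerret.curvature_succ o hc hJu ht, FrenetSerret.frenetFrame_eq o hc ht (by omega),
      real_inner_smul_left, hin, hvol, hvol, hvol, Finset.prod_range_succ _ (k + 1),
      Finset.prod_range_succ _ k, Nat.add_sub_cancel]
    congr 1
    field_simp
  · obtain ⟨k, rfl⟩ : ∃ k, n = k + 2 := ⟨n - 2, by omega⟩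
    have h0 := hne (i := k) (by omega)
    have hv := hvne (k := k) (by omega)
    -- For the last frame vector the inner product with `c^{(n)}` carries a sign and may vanish; the
    -- determinant records it, in place of the volume.
    have hdet : FrenetSerret.curveDet o J c t =
        (∏ i ∈ Finset.range (k + 1), ‖FrenetSerret.orthoDeriv (k + 2) J c i t‖) *
          inner ℝ (FrenetSerret.frenetFrame o J c ⟨k + 1, by omega⟩ t)
            (FrenetSerret.curveDeriv (k + 2) J c (k + 1) t) :=
      FrenetSerret.volumeForm_eq_prod_mul_inner (o.orient (c t))
        (fun i ↦ FrenetSerret.curveDeriv (k + 2) J c i t) (m := k + 1) rfl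
        fun i hi ↦ hc.orthoDeriv_ne_zero ht (by omega)
    simp only [Nat.add_sub_cancel, show k + 2 - 1 = k + 1 from rfl]
    rw [FrenetSerret.curvature_succ o hc hJu ht, hdet, hvol, hvol, Finset.prod_range_succ _ k]
    congr 1
    field_simp
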